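/- Let $0<\alpha<1$ and $w(t)=(1+t)^{\alpha}$. For $n\ge 0$ let $\varphi_n=\sqrt{n+\tfrac12}\,P_n$, where $P_n$ is the Legendre polynomial of degree $n$, so that $\{\varphi_n\}_{n\ge0}$ is an orthonormal basis of $L^2(-1,1)$, and let $\psi_n=w\varphi_n$. For even $N\geq 2$ let $\mathbf{G}_N\in\mathbb{C}^{N\times N}$ be the Gram matrix, with respect to the inner product of $L^2(-1,1)$, of the $N$ functions $\varphi_0,\dots,\varphi_{N/2-1},\psi_0,\dots,\psi_{N/2-1}$, and let $\kappa(\mathbf{G}_N)=\|\mathbf{G}_N\|\,\|\mathbf{G}_N^{-1}\|$ be its condition number in the spectral norm. Then $\kappa(\mathbf{G}_N)\gtrsim 4^N$ as $N\to\infty$ up to an algebraic factor in $N$; that is, there exist $k\in\mathbb{N}$ and $c>0$, depending only on $\alpha$, such that $$\kappa(\mathbf{G}_N)\ \ge\ c\,N^{-k}\,4^{N}$$ for all sufficiently large even $N$. -/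

import Mathlib

open MeasureTheory Polynomial

noncomputable section

namespace LegendreFrame

/-- The `n`-th Legendre polynomial, by Rodrigues' formula
`P_n = (2^n n!)⁻¹ (d/dx)^n (x^2 - 1)^n`. -/
def legendreP (n : ℕ) : ℝ[X] :=
  C ((2 ^ n * (n.factorial : ℝ))⁻¹) * (derivative^[n] ((X ^ 2 - 1) ^ n))

/-- The `L²(-1,1)`-normalized Legendre polynomial of degree `n`, as a function. -/
def legendreFun (n : ℕ) (t : ℝ) : ℝ :=
  Real.sqrt ((n : ℝ) + 1 / 2) * (legendreP n).eval t

/-- The weight `w(t) = (1+t)^α`. -/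
def weight (α : ℝ) (t : ℝ) : ℝ := (1 + t) ^ α

/-- The functions `φ_n` (left summand) and `w φ_n` (right summand); `n` is the degree, `n ≥ 0`. -/
def systemFun (α : ℝ) : ℕ ⊕ ℕ → ℝ → ℂ
  | Sum.inl n => fun t => (legendreFun n t : ℂ)
  | Sum.inr n => fun t => ((weight α t * legendreFun n t : ℝ) : ℂ)

/-- Lebesgue measure on `(-1,1)`. -/
abbrev intervalMeasure : Measure ℝ := volume.restrict (Set.Ioo (-1 : ℝ) 1)

/-- The complex Hilbert space `L²(-1,1)`. -/
abbrev L2Interval : Type := Lp ℂ 2 intervalMeasure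

theorem continuous_legendreFun (n : ℕ) : Continuous (legendreFun n) :=
  continuous_const.mul (legendreP n).continuous

theorem continuous_systemFun {α : ℝ} (hα : 0 < α) (i : ℕ ⊕ ℕ) : Continuous (systemFun α i) := by
  cases i with
  | inl n => exact Complex.continuous_ofReal.comp (continuous_legendreFun n)
  | inr n =>
    refine Complex.continuous_ofReal.comp (Continuous.mul ?_ (continuous_legendreFun n))
    exact (continuous_const.add continuous_id).rpow_const fun _ => Or.inr hα.le

theorem memLp_systemFun {α : ℝ} (hα : 0 < α) (i : ℕ ⊕ ℕ) :
    MemLp (systemFun α i) 2 intervalMeasure := by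
  have hc := continuous_systemFun hα i
  obtain ⟨K, hK⟩ := (isCompact_Icc (a := (-1 : ℝ)) (b := 1)).exists_bound_of_continuousOn
    hc.continuousOn
  refine MemLp.of_bound hc.aestronglyMeasurable K ?_
  filter_upwards [ae_restrict_mem measurableSet_Ioo] with t ht
  exact hK t (Set.Ioo_subset_Icc_self ht)

/-- The system `Φ = {φ_n} ∪ {w φ_n}` in `L²(-1,1)`. -/
def system (α : ℝ) (hα : 0 < α) (i : ℕ ⊕ ℕ) : L2Interval :=
  (memLp_systemFun hα i).toLp (systemFun α i)

/-- The truncated system `Φ_N` (for even `N`): the elements `φ_n` and `w φ_n` with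
`0 ≤ n < N / 2`. -/
def truncatedSystem (α : ℝ) (hα : 0 < α) (N : ℕ) (i : Fin (N / 2) ⊕ Fin (N / 2)) : L2Interval :=
  system α hα (Sum.map Fin.val Fin.val i)

/-- The truncated Gram matrix `G_N`. -/
def gramMatrix (α : ℝ) (hα : 0 < α) (N : ℕ) :
    Matrix (Fin (N / 2) ⊕ Fin (N / 2)) (Fin (N / 2) ⊕ Fin (N / 2)) ℂ :=
  Matrix.gram ℂ (truncatedSystem α hα N)

/-- The condition number `‖A‖ ‖A⁻¹‖` in the spectral norm, i.e. the operator norm induced by the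
Euclidean norm. (It is `0` for a singular matrix, by the convention for `A⁻¹`, so a positive lower
bound on it contains the invertibility of `A`.) -/
def condNumber {ι : Type*} [Fintype ι] [DecidableEq ι] (A : Matrix ι ι ℂ) : ℝ :=
  ‖Matrix.toEuclideanCLM (𝕜 := ℂ) A‖ * ‖Matrix.toEuclideanCLM (𝕜 := ℂ) A⁻¹‖

end LegendreFrame

end

/-
The Müntz polynomial `f` with exponents `k` and `k + α`, `k ≤ m`, whose coefficients are the
barycentric weights, is a divided difference of `y ↦ x ^ (-y)`. It is antitone on `(0, 1]`, so
`0 ≤ f ≤ W`, where `W` is its constant coefficient. The coefficients of the powers `x ^ k` are at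
least `(m.choose k) ^ 2 * W`, so `f` is the sum of a polynomial `p` with
`p(1) ≥ m.centralBinom * W` and a polynomial multiple of `x ^ α` that cancels it down to size `W`.
As `φ_n(1) = √(n + 1/2)`, the coefficient vector of `p` in the functions `φ_n` has, up to powers of
`m`, at least the size `4 ^ m * W`, while `f` itself is at most `W`. Hence the
inverse of the Gram matrix has norm at least about `16 ^ m`, and `N = 2 * (m + 1)`.
-/

namespace LegendreFrame

section Gram

variable {𝕜 ι E : Type*} [RCLike 𝕜] [Fintype ι] [DecidableEq ι] [NormedAddCommGroup E]
  [InnerProductSpace 𝕜 E]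

theorem inner_toEuclideanCLM_gram (v : ι → E) (x y : EuclideanSpace 𝕜 ι) :
    inner 𝕜 x (Matrix.toEuclideanCLM (𝕜 := 𝕜) (Matrix.gram 𝕜 v) y) =
      inner 𝕜 (∑ i, x i • v i) (∑ i, y i • v i) := by
  rw [← Matrix.star_dotProduct_gram_mulVec, EuclideanSpace.inner_eq_star_dotProduct,
    Matrix.ofLp_toEuclideanCLM, dotProduct_comm]

theorem norm_sq_le_norm_gram (v : ι → E) (i : ι) :
    ‖v i‖ ^ 2 ≤ ‖Matrix.toEuclideanCLM (𝕜 := 𝕜) (Matrix.gram 𝕜 v)‖ := by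
  set G := Matrix.toEuclideanCLM (𝕜 := 𝕜) (Matrix.gram 𝕜 v)
  set e : EuclideanSpace 𝕜 ι := EuclideanSpace.single i 1
  have hsum : ∑ j, e j • v j = v i := by simp [e]
  have hinner : inner 𝕜 e (G e) = inner 𝕜 (v i) (v i) := by
    rw [inner_toEuclideanCLM_gram, hsum]
  calc ‖v i‖ ^ 2 = ‖inner 𝕜 e (G e)‖ := by
        rw [hinner, inner_self_eq_norm_sq_to_K]
        simp
    _ ≤ ‖e‖ * (‖G‖ * ‖e‖) := (norm_inner_le_norm _ _).trans (by gcongr; exact G.le_opNorm e)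
    _ = ‖G‖ := by simp [e]

theorem norm_sq_le_norm_sum_sq_mul_norm_gram_inv {v : ι → E} (hv : LinearIndependent 𝕜 v)
    (z : EuclideanSpace 𝕜 ι) :
    ‖z‖ ^ 2 ≤ ‖∑ i, z i • v i‖ ^ 2 *
      ‖Matrix.toEuclideanCLM (𝕜 := 𝕜) (Matrix.gram 𝕜 v)⁻¹‖ := by
  set G := Matrix.gram 𝕜 v
  set H := Matrix.toEuclideanCLM (𝕜 := 𝕜) G⁻¹ with hH
  set y := H z
  have hGy : Matrix.toEuclideanCLM (𝕜 := 𝕜) G y = z := by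
    have hdet : IsUnit G.det :=
      isUnit_iff_ne_zero.mpr (Matrix.det_gram_ne_zero_iff_linearIndependent.mpr hv)
    rw [← mul_apply_eq_comp, hH, ← map_mul, Matrix.mul_nonsing_inv G hdet, map_one,
      one_apply_eq_self]
  have hinner (x : EuclideanSpace 𝕜 ι) :
      inner 𝕜 x z = inner 𝕜 (∑ i, x i • v i) (∑ i, y i • v i) := by
    rw [← inner_toEuclideanCLM_gram, hGy]
  have hz : ‖z‖ ^ 2 ≤ ‖∑ i, z i • v i‖ * ‖∑ i, y i • v i‖ :=
    calc ‖z‖ ^ 2 = ‖inner 𝕜 z z‖ := by simp [inner_self_eq_norm_sq_to_K]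
      _ ≤ _ := hinner z ▸ norm_inner_le_norm _ _
  have hy : ‖∑ i, y i • v i‖ ^ 2 ≤ ‖H‖ * ‖z‖ ^ 2 :=
    calc ‖∑ i, y i • v i‖ ^ 2 = ‖inner 𝕜 y z‖ := by simp [hinner y, inner_self_eq_norm_sq_to_K]
      _ ≤ ‖H‖ * ‖z‖ * ‖z‖ := (norm_inner_le_norm y z).trans (by gcongr; exact H.le_opNorm z)
      _ = ‖H‖ * ‖z‖ ^ 2 := by ring
  rcases (norm_nonneg z).eq_or_lt with hz₀ | hz₀
  · rw [← hz₀, zero_pow two_ne_zero]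
    positivity
  refine le_of_mul_le_mul_right ?_ (pow_pos hz₀ 2)
  calc ‖z‖ ^ 2 * ‖z‖ ^ 2 = (‖z‖ ^ 2) ^ 2 := (sq _).symm
    _ ≤ (‖∑ i, z i • v i‖ * ‖∑ i, y i • v i‖) ^ 2 := by gcongr
    _ = ‖∑ i, z i • v i‖ ^ 2 * ‖∑ i, y i • v i‖ ^ 2 := mul_pow _ _ 2
    _ ≤ ‖∑ i, z i • v i‖ ^ 2 * (‖H‖ * ‖z‖ ^ 2) := by gcongr
    _ = ‖∑ i, z i • v i‖ ^ 2 * ‖H‖ * ‖z‖ ^ 2 := (mul_assoc _ _ _).symm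

theorem norm_sq_mul_norm_sq_le_condNumber_gram [InnerProductSpace ℂ E] {v : ι → E}
    (hv : LinearIndependent ℂ v) (i : ι) (z : EuclideanSpace ℂ ι) :
    ‖v i‖ ^ 2 * ‖z‖ ^ 2 ≤ ‖∑ j, z j • v j‖ ^ 2 * condNumber (Matrix.gram ℂ v) := by
  rw [condNumber, mul_left_comm]
  exact mul_le_mul (norm_sq_le_norm_gram v i) (norm_sq_le_norm_sum_sq_mul_norm_gram_inv hv z)
    (by positivity) (norm_nonneg _)

end Gram

section DividedDifference

variable {ι : Type*} [DecidableEq ι]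

theorem nodalWeight_insert_mul_sub {K : Type*} [Field K] {s : Finset ι} {v : ι → K} {c i : ι}
    (hc : c ∉ s) (hi : i ∈ s) (hne : v i ≠ v c) :
    Lagrange.nodalWeight (insert c s) v i * (v i - v c) = Lagrange.nodalWeight s v i := by
  have hci : c ≠ i := fun h => hc (h ▸ hi)
  rw [Lagrange.nodalWeight, Finset.erase_insert_of_ne hci,
    Finset.prod_insert fun h => hc (Finset.mem_of_mem_erase h), mul_right_comm,
    inv_mul_cancel₀ (sub_ne_zero.mpr hne), one_mul, Lagrange.nodalWeight]

theorem sum_nodalWeight_eq_zero {K : Type*} [Field K] {s : Finset ι} {v : ι → K}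
    (hv : Set.InjOn v s) (hs : 1 < s.card) : ∑ i ∈ s, Lagrange.nodalWeight s v i = 0 := by
  have h := Lagrange.coeff_eq_sum hv (P := (1 : K[X])) (by
    rw [degree_one]; exact_mod_cast zero_lt_one.trans hs)
  rw [coeff_one, if_neg (by lia)] at h
  simpa only [Lagrange.nodalWeight, Finset.prod_inv_distrib, eval_one, one_div] using h.symm

/-- The Müntz polynomial with exponents `e i`, `i ∈ s`, whose coefficients are the barycentric
weights of the nodes `-e i`. It is the divided difference of `y ↦ x ^ (-y)` at the nodes `-e i`;
negating the exponents makes it nonnegative on `(0, 1]`, whatever the number of nodes. -/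
noncomputable def muntz (s : Finset ι) (e : ι → ℝ) (x : ℝ) : ℝ :=
  ∑ i ∈ s, Lagrange.nodalWeight s (-e) i * x ^ e i

theorem muntz_one_eq_zero {s : Finset ι} {e : ι → ℝ} (he : Set.InjOn e s) (hs : 1 < s.card) :
    muntz s e 1 = 0 := by
  simpa only [muntz, Real.one_rpow, mul_one] using
    sum_nodalWeight_eq_zero (v := -e) (neg_injective.comp_injOn he) hs

theorem muntz_eq_sum_insert {s : Finset ι} {e : ι → ℝ} {c : ι} (hc : c ∉ s)
    (he : Set.InjOn e (insert c s : Finset ι)) (x : ℝ) :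
    muntz s e x =
      ∑ i ∈ insert c s, Lagrange.nodalWeight (insert c s) (-e) i * (e c - e i) * x ^ e i := by
  rw [Finset.sum_insert hc, sub_self, mul_zero, zero_mul, zero_add, muntz]
  refine Finset.sum_congr rfl fun i hi => ?_
  have hne : e i ≠ e c := fun h => hc <|
    he (Finset.mem_insert_of_mem hi) (Finset.mem_insert_self c s) h ▸ hi
  rw [← nodalWeight_insert_mul_sub (v := -e) hc hi (neg_injective.ne hne), Pi.neg_apply,
    Pi.neg_apply, neg_sub_neg]

theorem hasDerivAt_rpow_neg_mul_muntz_insert {s : Finset ι} {e : ι → ℝ} {c : ι} (hc : c ∉ s)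
    (he : Set.InjOn e (insert c s : Finset ι)) {x : ℝ} (hx : 0 < x) :
    HasDerivAt (fun x => x ^ (-e c) * muntz (insert c s) e x)
      (-(x ^ (-e c - 1) * muntz s e x)) x := by
  have hpow (b : ℝ) : HasDerivAt (fun x : ℝ => x ^ b) (b * x ^ (b - 1)) x :=
    Real.hasDerivAt_rpow_const (Or.inl hx.ne')
  have hsum := HasDerivAt.fun_sum (u := insert c s)
    fun i _ => (hpow (e i)).const_mul (Lagrange.nodalWeight (insert c s) (-e) i)
  refine ((hpow (-e c)).mul hsum).congr_deriv ?_
  simp only [muntz_eq_sum_insert hc he, Real.rpow_sub_one hx.ne', Finset.mul_sum,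
    ← Finset.sum_add_distrib, ← Finset.sum_neg_distrib]
  exact Finset.sum_congr rfl fun i _ => by ring

theorem antitoneOn_rpow_neg_mul_muntz_insert {s : Finset ι} {e : ι → ℝ} {c : ι} (hc : c ∉ s)
    (he : Set.InjOn e (insert c s : Finset ι)) (hs : ∀ x ∈ Set.Ioc (0 : ℝ) 1, 0 ≤ muntz s e x) :
    AntitoneOn (fun x => x ^ (-e c) * muntz (insert c s) e x) (Set.Ioc 0 1) := by
  have hderiv {x : ℝ} (hx : 0 < x) := hasDerivAt_rpow_neg_mul_muntz_insert hc he hx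
  refine antitoneOn_of_deriv_nonpos (convex_Ioc 0 1)
    (fun x hx => (hderiv hx.1).continuousAt.continuousWithinAt) ?_ ?_ <;>
    intro x hx <;> rw [interior_Ioc] at hx
  · exact (hderiv hx.1).differentiableAt.differentiableWithinAt
  · rw [(hderiv hx.1).deriv]
    exact neg_nonpos.mpr <|
      mul_nonneg (Real.rpow_nonneg hx.1.le _) (hs x (Set.Ioo_subset_Ioc_self hx))

theorem muntz_nonneg {s : Finset ι} {e : ι → ℝ} (he : Set.InjOn e s) :
    ∀ x ∈ Set.Ioc (0 : ℝ) 1, 0 ≤ muntz s e x := by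
  induction s using Finset.induction_on with
  | empty => simp [muntz]
  | insert c s hc ih =>
    intro x hx
    rcases s.eq_empty_or_nonempty with rfl | hs
    · simpa [muntz, Lagrange.nodalWeight] using Real.rpow_nonneg hx.1.le (e c)
    have hone : muntz (insert c s) e 1 = 0 := muntz_one_eq_zero he <| by
      rw [Finset.card_insert_of_notMem hc]
      exact Nat.lt_add_of_pos_left hs.card_pos
    have hle := antitoneOn_rpow_neg_mul_muntz_insert hc he (ih (he.mono (by simp))) hx
      (Set.right_mem_Ioc.mpr one_pos) hx.2
    simp only [hone, mul_zero] at hle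
    exact nonneg_of_mul_nonneg_right hle (Real.rpow_pos_of_pos hx.1 _)

theorem muntz_le_nodalWeight {s : Finset ι} {e : ι → ℝ} {c : ι} (hc : c ∈ s)
    (he : Set.InjOn e s) (hec : e c = 0) (hpos : ∀ i ∈ s, i ≠ c → 0 < e i) {x : ℝ}
    (hx : x ∈ Set.Ioc (0 : ℝ) 1) : muntz s e x ≤ Lagrange.nodalWeight s (-e) c := by
  have hanti : AntitoneOn (muntz s e) (Set.Ioc 0 1) := by
    have h := antitoneOn_rpow_neg_mul_muntz_insert (Finset.notMem_erase c s)
      (by rwa [Finset.insert_erase hc]) (muntz_nonneg (he.mono (by simp)))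
    simpa only [Finset.insert_erase hc, hec, neg_zero, Real.rpow_zero, one_mul] using h
  have hzero : muntz s e 0 = Lagrange.nodalWeight s (-e) c := by
    rw [muntz, Finset.sum_eq_single_of_mem c hc fun i hi hic => by
      rw [Real.zero_rpow (hpos i hi hic).ne', mul_zero], hec, Real.rpow_zero, mul_one]
  have hcont : Continuous (muntz s e) := continuous_finsetSum _ fun i hi => by
    have hei : 0 ≤ e i := by
      rcases eq_or_ne i c with rfl | hic
      exacts [hec.ge, (hpos i hi hic).le]
    exact continuous_const.mul (Real.continuous_rpow_const hei)
  rw [← hzero]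
  refine ge_of_tendsto (hcont.continuousWithinAt (s := Set.Ioi 0)) ?_
  filter_upwards [Ioc_mem_nhdsGT hx.1] with y hy
  exact hanti ⟨hy.1, hy.2.trans hx.2⟩ hx hy.2

end DividedDifference

section Exponents

/-- The exponents `k` (left summand) and `k + α` (right summand) of the functions `x ^ k` and
`x ^ α * x ^ k`. -/
noncomputable def exponent (α : ℝ) : ℕ ⊕ ℕ → ℝ :=
  Sum.elim (fun k => (k : ℝ)) (fun k => (k : ℝ) + α)

/-- The indices of the exponents `k` and `k + α` with `k < n`. -/
def exponentIndex (n : ℕ) : Finset (ℕ ⊕ ℕ) := (Finset.range n).disjSum (Finset.range n)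

/-- The coefficients of the Müntz polynomial with the exponents `k` and `k + α`, `k < n`; the value
at `Sum.inl k` is the coefficient of `x ^ k`. -/
noncomputable def exponentWeight (α : ℝ) (n : ℕ) : ℕ ⊕ ℕ → ℝ :=
  Lagrange.nodalWeight (exponentIndex n) (-exponent α)

theorem exponent_injective {α : ℝ} (hα₀ : 0 < α) (hα₁ : α < 1) :
    Function.Injective (exponent α) := by
  have hne (a b : ℕ) : (a : ℝ) ≠ b + α := fun h => by
    have hlt : (b : ℝ) < a := by linarith
    have hgt : (a : ℝ) < b + 1 := by linarith
    norm_cast at hlt hgt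
    lia
  rintro (a | a) (b | b) h
  · simpa [exponent] using h
  · exact (hne a b h).elim
  · exact (hne b a h.symm).elim
  · simpa [exponent] using h

theorem sum_exponentIndex_mul_rpow (α : ℝ) (n : ℕ) (c : ℕ ⊕ ℕ → ℂ) {x : ℝ} (hx : 0 < x) :
    ∑ i ∈ exponentIndex n, c i * (x ^ exponent α i : ℝ) =
      ∑ k ∈ Finset.range n, c (Sum.inl k) * (x : ℂ) ^ k +
        (x ^ α : ℝ) * ∑ k ∈ Finset.range n, c (Sum.inr k) * (x : ℂ) ^ k := by
  rw [exponentIndex, Finset.sum_disjSum, Finset.mul_sum]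
  congr 1 <;> refine Finset.sum_congr rfl fun k _ => ?_
  · simp [exponent]
  · rw [exponent, Sum.elim_inr, Real.rpow_add hx, Real.rpow_natCast, Complex.ofReal_mul,
      Complex.ofReal_pow]
    ring

/-- The product `k! (1 + a)_k`, where `(1 + a)_k` is the rising factorial. It is the product of
the differences between an integer `j` and the exponents `j + i`, `j + i + α` (for `a = α`), or
`j - i`, `j - i + α` (for `a = -α`), where `1 ≤ i ≤ k`. -/
noncomputable def factorialMulRising (a : ℝ) (k : ℕ) : ℝ :=
  ∏ i ∈ Finset.range k, ((i : ℝ) + 1) * (i + 1 + a)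

theorem factorialMulRising_pos {a : ℝ} (ha : -1 < a) (k : ℕ) : 0 < factorialMulRising a k :=
  Finset.prod_pos fun i _ => by
    have : (0 : ℝ) ≤ i := i.cast_nonneg
    exact mul_pos (by linarith) (by linarith)

theorem factorialMulRising_le_factorial_sq {a : ℝ} (ha : -1 ≤ a) (ha₀ : a ≤ 0) (k : ℕ) :
    factorialMulRising a k ≤ (k.factorial : ℝ) ^ 2 := by
  rw [← Finset.prod_range_add_one_eq_factorial, Nat.cast_prod, ← Finset.prod_pow]
  refine Finset.prod_le_prod (fun i _ => ?_) (fun i _ => ?_) <;>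
    have : (0 : ℝ) ≤ i := i.cast_nonneg
  · exact mul_nonneg (by linarith) (by linarith)
  · push_cast
    nlinarith

theorem choose_mul_factorial_sq_mul_le_factorialMulRising_add {a : ℝ} (ha : 0 ≤ a) (k r : ℕ) :
    ((k + r).choose k * k.factorial : ℝ) ^ 2 * factorialMulRising a r ≤
      factorialMulRising a (k + r) := by
  have hasc : ((k + r).choose k * k.factorial : ℝ) = ∏ i ∈ Finset.range k, ((r : ℝ) + 1 + i) := by
    rw [add_comm k r, mul_comm]
    exact_mod_cast (r.ascFactorial_eq_factorial_mul_choose k).symm.trans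
      (Nat.ascFactorial_eq_prod_range (r + 1) k)
  have hsplit : factorialMulRising a (k + r) = factorialMulRising a r *
      ∏ i ∈ Finset.range k, (((r + i : ℕ) : ℝ) + 1) * ((r + i : ℕ) + 1 + a) := by
    rw [add_comm k r, factorialMulRising, Finset.prod_range_add, ← factorialMulRising]
  rw [hasc, hsplit, mul_comm, ← Finset.prod_pow]
  refine mul_le_mul_of_nonneg_left ?_ (factorialMulRising_pos (by linarith) r).le
  refine Finset.prod_le_prod (fun i _ => by positivity) (fun i _ => ?_)
  have : (0 : ℝ) ≤ r + i := by positivity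
  push_cast
  nlinarith

theorem prod_range_erase {M : Type*} [CommMonoid M] (f : ℕ → M) (k r : ℕ) :
    ∏ j ∈ (Finset.range (k + 1 + r)).erase k, f j =
      (∏ j ∈ Finset.range k, f j) * ∏ i ∈ Finset.range r, f (k + 1 + i) := by
  induction r with
  | zero => simp [Finset.range_add_one]
  | succ r ih =>
    rw [← add_assoc, Finset.range_add_one, Finset.erase_insert_of_ne (by lia),
      Finset.prod_insert (by simp), ih, Finset.prod_range_succ, mul_comm, mul_assoc]

theorem exponentWeight_inl (α : ℝ) (k r : ℕ) :
    exponentWeight α (k + 1 + r) (Sum.inl k) =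
      (α * (factorialMulRising (-α) k * factorialMulRising α r))⁻¹ := by
  have herase : (exponentIndex (k + 1 + r)).erase (Sum.inl k) =
      ((Finset.range (k + 1 + r)).erase k).disjSum (Finset.range (k + 1 + r)) := by
    ext (j | j) <;> simp [exponentIndex]
  have hprod : ∏ j ∈ (Finset.range (k + 1 + r)).erase k, ((j : ℝ) - k) * (j - k + α) =
      factorialMulRising (-α) k * factorialMulRising α r := by
    rw [prod_range_erase, ← Finset.prod_range_reflect]
    congr 1 <;> refine Finset.prod_congr rfl fun i hi => ?_
    · have hik : ((k - 1 - i : ℕ) : ℝ) = k - 1 - i := by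
        rw [Nat.sub_sub, Nat.cast_sub (by have := Finset.mem_range.mp hi; lia)]
        push_cast
        ring
      rw [hik]
      ring
    · push_cast
      ring
  rw [← hprod, exponentWeight, Lagrange.nodalWeight, herase, Finset.prod_disjSum,
    ← Finset.mul_prod_erase (Finset.range _) _ (Finset.mem_range.mpr (by lia : k < k + 1 + r)),
    mul_left_comm, ← Finset.prod_mul_distrib, mul_inv, ← Finset.prod_inv_distrib]
  congr 1
  · simp [exponent]
  · refine Finset.prod_congr rfl fun j _ => ?_
    simp [exponent]
    ring

theorem exponentWeight_inl_zero (α : ℝ) (m : ℕ) :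
    exponentWeight α (m + 1) (Sum.inl 0) = (α * factorialMulRising α m)⁻¹ := by
  have hempty : factorialMulRising (-α) 0 = 1 := Finset.prod_range_zero _
  rw [← zero_add 1, add_comm m, exponentWeight_inl, hempty, one_mul]

theorem choose_sq_mul_exponentWeight_le {α : ℝ} (hα₀ : 0 < α) (hα₁ : α < 1) {m k : ℕ}
    (hk : k ≤ m) :
    (m.choose k : ℝ) ^ 2 * exponentWeight α (m + 1) (Sum.inl 0) ≤
      exponentWeight α (m + 1) (Sum.inl k) := by
  obtain ⟨r, rfl⟩ := Nat.exists_eq_add_of_le hk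
  rw [exponentWeight_inl_zero, add_right_comm, exponentWeight_inl, ← div_eq_mul_inv]
  have hk₀ := factorialMulRising_pos (neg_lt_neg hα₁) k
  have hr₀ := factorialMulRising_pos (by linarith : -1 < α) r
  have hkr₀ := factorialMulRising_pos (by linarith : -1 < α) (k + r)
  rw [← one_div, div_le_div_iff₀ (by positivity) (by positivity), one_mul, mul_left_comm]
  refine mul_le_mul_of_nonneg_left ?_ hα₀.le
  calc ((k + r).choose k : ℝ) ^ 2 * (factorialMulRising (-α) k * factorialMulRising α r)
      ≤ ((k + r).choose k : ℝ) ^ 2 * ((k.factorial : ℝ) ^ 2 * factorialMulRising α r) := by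
        gcongr
        exact factorialMulRising_le_factorial_sq (by linarith) (by linarith) k
    _ = ((k + r).choose k * k.factorial : ℝ) ^ 2 * factorialMulRising α r := by ring
    _ ≤ factorialMulRising α (k + r) :=
        choose_mul_factorial_sq_mul_le_factorialMulRising_add hα₀.le k r

theorem centralBinom_mul_exponentWeight_le_sum {α : ℝ} (hα₀ : 0 < α) (hα₁ : α < 1) (m : ℕ) :
    m.centralBinom * exponentWeight α (m + 1) (Sum.inl 0) ≤
      ∑ k ∈ Finset.range (m + 1), exponentWeight α (m + 1) (Sum.inl k) := by
  rw [Nat.centralBinom, ← Nat.sum_range_choose_sq, Nat.cast_sum, Finset.sum_mul]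
  refine Finset.sum_le_sum fun k hk => ?_
  rw [Nat.cast_pow]
  exact choose_sq_mul_exponentWeight_le hα₀ hα₁ (Nat.lt_succ_iff.mp (Finset.mem_range.mp hk))

theorem muntz_exponent_mem_Icc {α : ℝ} (hα₀ : 0 < α) (hα₁ : α < 1) (m : ℕ) {x : ℝ}
    (hx : x ∈ Set.Ioc (0 : ℝ) 1) :
    muntz (exponentIndex (m + 1)) (exponent α) x ∈
      Set.Icc 0 (exponentWeight α (m + 1) (Sum.inl 0)) := by
  have hinj := (exponent_injective hα₀ hα₁).injOn (s := exponentIndex (m + 1))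
  refine ⟨muntz_nonneg hinj x hx, muntz_le_nodalWeight ?_ hinj Nat.cast_zero ?_ hx⟩
  · simp [exponentIndex]
  · rintro (k | k) _ hk
    · exact Nat.cast_pos.mpr (Nat.pos_of_ne_zero fun h => hk (congrArg Sum.inl h))
    · exact add_pos_of_nonneg_of_pos k.cast_nonneg hα₀

end Exponents

section Independence

theorem linearIndependent_rpow :
    LinearIndependent ℂ fun (e : ℝ) (x : Set.Ioc (0 : ℝ) 1) => (((x : ℝ) ^ e : ℝ) : ℂ) := by
  -- Power functions are characters of the monoid `(0, 1]`, so Dedekind's theorem applies.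
  let character (e : ℝ) : Set.Ioc (0 : ℝ) 1 →* ℂ :=
    { toFun := fun x => (((x : ℝ) ^ e : ℝ) : ℂ)
      map_one' := by simp
      map_mul' := fun x y => by
        rw [Set.Ioc.coe_mul, Real.mul_rpow x.2.1.le y.2.1.le, Complex.ofReal_mul] }
  have hinj : Function.Injective character := fun a b hab => by
    have hhalf := DFunLike.congr_fun hab ⟨1 / 2, by norm_num, by norm_num⟩
    have hhalf' : (1 / 2 : ℝ) ^ a = (1 / 2) ^ b := Complex.ofReal_injective hhalf
    exact (Real.rpow_right_inj (by norm_num) (by norm_num)).mp hhalf'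
  exact (linearIndependent_monoidHom (Set.Ioc (0 : ℝ) 1) ℂ).comp character hinj

theorem eq_zero_of_eval_add_rpow_mul_eval_eq_zero {α : ℝ}
    (hα : Function.Injective (exponent α)) {p q : ℂ[X]}
    (h : ∀ x ∈ Set.Ioc (0 : ℝ) 1, p.eval (x : ℂ) + ((x ^ α : ℝ) : ℂ) * q.eval (x : ℂ) = 0) :
    p = 0 ∧ q = 0 := by
  set n := max p.natDegree q.natDegree + 1
  have hpn : p.natDegree < n := by lia
  have hqn : q.natDegree < n := by lia
  have hcoeff := linearIndependent_iff'.mp (linearIndependent_rpow.comp _ hα) (exponentIndex n)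
    (Sum.elim p.coeff q.coeff) <| by
      ext x
      simpa [Finset.sum_apply, sum_exponentIndex_mul_rpow α n _ x.2.1, eval_eq_sum_range' hpn,
        eval_eq_sum_range' hqn] using h x x.2
  constructor <;> ext k <;> rw [coeff_zero] <;> rcases lt_or_ge k n with hk | hk
  · exact hcoeff (Sum.inl k) (by simpa [exponentIndex] using hk)
  · exact coeff_eq_zero_of_natDegree_lt (hpn.trans_le hk)
  · exact hcoeff (Sum.inr k) (by simpa [exponentIndex] using hk)
  · exact coeff_eq_zero_of_natDegree_lt (hqn.trans_le hk)

end Independence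

section Legendre

theorem eval_one_legendreP (n : ℕ) : (legendreP n).eval 1 = 1 := by
  have hfactor : ((X ^ 2 - 1) ^ n : ℝ[X]).map (algebraMap ℝ ℝ) =
      (X - C 1) ^ n * (X + C 1) ^ n := by
    rw [Algebra.algebraMap_self, map_id, ← mul_pow, C_1]
    ring
  have hderiv := aeval_iterate_derivative_self _ n (1 : ℝ) hfactor
  rw [coe_aeval_eq_eval, eval_pow, eval_add, eval_X, eval_C, one_add_one_eq_two,
    nsmul_eq_mul] at hderiv
  rw [legendreP, eval_mul, eval_C, hderiv, mul_comm (n.factorial : ℝ), inv_mul_cancel₀]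
  positivity

theorem natDegree_iterate_derivative_eq {R : Type*} [Semiring R]
    [IsAddTorsionFree R] (p : R[X]) (k : ℕ) :
    (derivative^[k] p).natDegree = p.natDegree - k := by
  induction k with
  | zero => rfl
  | succ k ih => rw [Function.iterate_succ_apply', natDegree_derivative, ih, Nat.sub_sub]

theorem degree_legendreP (n : ℕ) : (legendreP n).degree = n := by
  have hne : legendreP n ≠ 0 := fun h => by simpa [h] using eval_one_legendreP n
  have hbase : ((X ^ 2 - 1 : ℝ[X]) ^ n).natDegree = n * 2 := by
    rw [natDegree_pow, ← C_1, natDegree_X_pow_sub_C]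
  have hc : (2 ^ n * (n.factorial : ℝ))⁻¹ ≠ 0 := by positivity
  rw [degree_eq_natDegree hne, legendreP, natDegree_C_mul hc,
    natDegree_iterate_derivative_eq, hbase, mul_two, Nat.add_sub_cancel]

/-- The `L²(-1, 1)`-normalized Legendre polynomials with complex coefficients, as a polynomial
sequence: the `n`-th term has degree `n`, so the first `n` terms span the polynomials of degree
less than `n`. -/
noncomputable def legendreSeq : Polynomial.Sequence ℂ where
  elems' n := C (Real.sqrt ((n : ℝ) + 1 / 2) : ℂ) * (legendreP n).map Complex.ofRealHom
  degree_eq' n := by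
    rw [degree_C_mul, degree_map, degree_legendreP]
    exact_mod_cast (Real.sqrt_pos.mpr (by positivity)).ne'

theorem eval_legendreSeq (n : ℕ) (t : ℝ) : (legendreSeq n).eval (t : ℂ) = legendreFun n t := by
  change (C _ * _).eval _ = _
  rw [eval_mul, eval_C, legendreFun, Complex.ofReal_mul]
  exact congrArg _ (eval_map_apply Complex.ofRealHom t)

theorem norm_eval_one_legendreSeq_sq (n : ℕ) : ‖(legendreSeq n).eval 1‖ ^ 2 = n + 1 / 2 := by
  rw [← Complex.ofReal_one, eval_legendreSeq, legendreFun, eval_one_legendreP, mul_one,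
    Complex.norm_real, Real.norm_eq_abs, sq_abs, Real.sq_sqrt (by positivity)]

theorem exists_sum_legendreSeq {n : ℕ} {p : ℂ[X]} (hp : p.degree < n) :
    ∃ z : Fin n → ℂ, ∑ i, z i • legendreSeq i = p := by
  have hspan := legendreSeq.span_degreeLT (m := n)
    fun i _ => (leadingCoeff_ne_zero.mpr (legendreSeq.ne_zero i)).isUnit
  have hrange : Set.range (fun i : Fin n => legendreSeq i) = legendreSeq '' Set.Iio n := by
    rw [← Fin.range_val, ← Set.range_comp, Function.comp_def]
  rw [← Submodule.mem_span_range_iff_exists_fun, hrange, hspan]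
  exact mem_degreeLT.mpr hp

theorem sum_range_add_half (n : ℕ) : ∑ i ∈ Finset.range n, ((i : ℝ) + 1 / 2) = n ^ 2 / 2 := by
  induction n with
  | zero => simp
  | succ n ih =>
    rw [Finset.sum_range_succ, ih]
    push_cast
    ring

theorem norm_eval_one_sum_legendreSeq_sq_le {n : ℕ} (z : Fin n → ℂ) :
    ‖(∑ i, z i • legendreSeq i).eval 1‖ ^ 2 ≤ (∑ i, ‖z i‖ ^ 2) * (n ^ 2 / 2) := by
  have hsum : ∑ i : Fin n, ‖(legendreSeq i).eval 1‖ ^ 2 = (n : ℝ) ^ 2 / 2 := by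
    simp only [norm_eval_one_legendreSeq_sq]
    rw [Fin.sum_univ_eq_sum_range (fun i => (i : ℝ) + 1 / 2), sum_range_add_half]
  rw [eval_finsetSum, ← hsum]
  calc ‖∑ i, (z i • legendreSeq i).eval 1‖ ^ 2
      ≤ (∑ i, ‖z i‖ * ‖(legendreSeq i).eval 1‖) ^ 2 := by
        gcongr
        refine (norm_sum_le _ _).trans_eq (Finset.sum_congr rfl fun i _ => ?_)
        rw [eval_smul, smul_eq_mul, norm_mul]
    _ ≤ _ := Finset.sum_mul_sq_le_sq_mul_sq _ _ _

end Legendre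

section ConditionNumber

theorem coeFn_sum_smul_truncatedSystem {α : ℝ} (hα : 0 < α) (N : ℕ)
    (c : Fin (N / 2) ⊕ Fin (N / 2) → ℂ) :
    (∑ i, c i • truncatedSystem α hα N i : L2Interval) =ᵐ[intervalMeasure] fun t =>
      (∑ i, c (Sum.inl i) • legendreSeq i).eval (t : ℂ) +
        (weight α t : ℂ) * (∑ i, c (Sum.inr i) • legendreSeq i).eval (t : ℂ) := by
  have hsmul (i : Fin (N / 2) ⊕ Fin (N / 2)) :
      (c i • truncatedSystem α hα N i : L2Interval) =ᵐ[intervalMeasure]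
        fun t => c i * systemFun α (Sum.map Fin.val Fin.val i) t := by
    filter_upwards [Lp.coeFn_smul (c i) (truncatedSystem α hα N i),
      (memLp_systemFun hα (Sum.map Fin.val Fin.val i)).coeFn_toLp] with t hsmul htoLp
    rw [hsmul, Pi.smul_apply, smul_eq_mul, truncatedSystem, system, htoLp]
  filter_upwards [Lp.coeFn_finsetSum Finset.univ fun i => c i • truncatedSystem α hα N i,
    Filter.eventually_all.mpr hsmul] with t hsum hsmul
  rw [hsum, Finset.sum_apply, Finset.sum_congr rfl fun i _ => hsmul i, Fintype.sum_sum_type,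
    eval_finsetSum, eval_finsetSum, Finset.mul_sum]
  congr 1 <;> refine Finset.sum_congr rfl fun i _ => ?_ <;>
    simp only [systemFun, eval_legendreSeq, Sum.map_inl, Sum.map_inr, eval_smul, smul_eq_mul,
      Complex.ofReal_mul, mul_left_comm]

theorem linearIndependent_truncatedSystem {α : ℝ} (hα₀ : 0 < α) (hα₁ : α < 1) (N : ℕ) :
    LinearIndependent ℂ (truncatedSystem α hα₀ N) := by
  rw [Fintype.linearIndependent_iff]
  intro c hc
  set p : ℂ[X] := ∑ i, c (Sum.inl i) • legendreSeq i
  set q : ℂ[X] := ∑ i, c (Sum.inr i) • legendreSeq i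
  have hae : (fun t : ℝ => p.eval (t : ℂ) + (weight α t : ℂ) * q.eval (t : ℂ))
      =ᵐ[intervalMeasure] fun _ => 0 := by
    have hcoe := coeFn_sum_smul_truncatedSystem hα₀ N c
    rw [hc] at hcoe
    exact hcoe.symm.trans (Lp.coeFn_zero ℂ 2 intervalMeasure)
  have hcont : Continuous fun t : ℝ => p.eval (t : ℂ) + (weight α t : ℂ) * q.eval (t : ℂ) := by
    have hweight : Continuous (weight α) :=
      (continuous_const.add continuous_id).rpow_const fun _ => Or.inr hα₀.le
    fun_prop
  have hzero : Set.EqOn _ _ (Set.Ioo (-1 : ℝ) 1) :=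
    Measure.eqOn_Ioo_of_ae_eq volume hae hcont.continuousOn continuousOn_const
  obtain ⟨hp, hq⟩ := eq_zero_of_eval_add_rpow_mul_eval_eq_zero (exponent_injective hα₀ hα₁)
    (p := taylor (-1) p) (q := taylor (-1) q) fun x hx => by
      have hx' : x - 1 ∈ Set.Ioo (-1 : ℝ) 1 := ⟨by linarith [hx.1], by linarith [hx.2]⟩
      simpa [weight, taylor_eval, sub_eq_add_neg] using hzero hx'
  have hindep := Fintype.linearIndependent_iff.mp <|
    legendreSeq.linearIndependent.comp _ (Fin.val_injective (n := N / 2))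
  rintro (i | i)
  exacts [hindep _ ((taylor_eq_zero _ _).mp hp) i, hindep _ ((taylor_eq_zero _ _).mp hq) i]

theorem intervalMeasure_univ : intervalMeasure Set.univ = 2 := by
  rw [Measure.restrict_apply_univ, Real.volume_Ioo]
  norm_num

theorem norm_sq_le_of_ae_bound {f : L2Interval} {K : ℝ} (hK : 0 ≤ K)
    (h : ∀ᵐ t ∂intervalMeasure, ‖f t‖ ≤ K) : ‖f‖ ^ 2 ≤ 2 * K ^ 2 := by
  have hvolume : ((measureUnivNNReal intervalMeasure : NNReal) : ℝ) = 2 := by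
    rw [measureUnivNNReal, ← ENNReal.toReal, intervalMeasure_univ, ENNReal.toReal_ofNat]
  have hnorm : ‖f‖ ≤ √2 * K := by
    rw [Real.sqrt_eq_rpow, one_div]
    simpa [hvolume] using Lp.norm_le_of_ae_bound hK h
  calc ‖f‖ ^ 2 ≤ (√2 * K) ^ 2 := by gcongr
    _ = 2 * K ^ 2 := by rw [mul_pow, Real.sq_sqrt zero_le_two]

theorem norm_system_inl_zero {α : ℝ} (hα : 0 < α) : ‖system α hα (Sum.inl 0)‖ = 1 := by
  have hconst : systemFun α (Sum.inl 0) = fun _ => ((√(1 / 2) : ℝ) : ℂ) := by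
    ext t
    simp [systemFun, legendreFun, legendreP]
  rw [system, Lp.norm_toLp, hconst, eLpNorm_const' _ two_ne_zero ENNReal.ofNat_ne_top,
    intervalMeasure_univ, ENNReal.toReal_mul, toReal_enorm, Complex.norm_real,
    Real.norm_of_nonneg (Real.sqrt_nonneg _), ← ENNReal.toReal_rpow, ENNReal.toReal_ofNat,
    ← Real.sqrt_eq_rpow, ← Real.sqrt_mul one_half_pos.le,
    one_div_mul_cancel two_ne_zero, Real.sqrt_one]

theorem norm_eval_one_sq_le_mul_condNumber {α : ℝ} (hα₀ : 0 < α) (hα₁ : α < 1) {N : ℕ}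
    (hN : 0 < N / 2) {p q : ℂ[X]} (hp : p.degree < (N / 2 : ℕ)) (hq : q.degree < (N / 2 : ℕ))
    {K : ℝ} (hK : ∀ t ∈ Set.Ioo (-1 : ℝ) 1,
      ‖p.eval (t : ℂ) + (weight α t : ℂ) * q.eval (t : ℂ)‖ ≤ K) :
    ‖p.eval 1‖ ^ 2 ≤ K ^ 2 * ((N / 2 : ℕ) : ℝ) ^ 2 * condNumber (gramMatrix α hα₀ N) := by
  obtain ⟨a, rfl⟩ := exists_sum_legendreSeq hp
  obtain ⟨b, rfl⟩ := exists_sum_legendreSeq hq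
  set z : EuclideanSpace ℂ (Fin (N / 2) ⊕ Fin (N / 2)) := WithLp.toLp 2 (Sum.elim a b)
  set f : L2Interval := ∑ i, z i • truncatedSystem α hα₀ N i
  have hK₀ : 0 ≤ K := (norm_nonneg _).trans (hK 0 (by norm_num))
  have hf : ‖f‖ ^ 2 ≤ 2 * K ^ 2 := by
    refine norm_sq_le_of_ae_bound hK₀ ?_
    filter_upwards [coeFn_sum_smul_truncatedSystem hα₀ N z,
      ae_restrict_mem measurableSet_Ioo] with t hft ht
    exact hft ▸ hK t ht
  have ha : ∑ i, ‖a i‖ ^ 2 ≤ ‖z‖ ^ 2 := by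
    rw [EuclideanSpace.norm_sq_eq, Fintype.sum_sum_type]
    exact le_add_of_nonneg_right (by positivity)
  have hz : ‖z‖ ^ 2 ≤ ‖f‖ ^ 2 * condNumber (gramMatrix α hα₀ N) := by
    have hone : ‖truncatedSystem α hα₀ N (Sum.inl ⟨0, hN⟩)‖ = 1 := norm_system_inl_zero hα₀
    simpa only [hone, one_pow, one_mul, gramMatrix] using norm_sq_mul_norm_sq_le_condNumber_gram
      (linearIndependent_truncatedSystem hα₀ hα₁ N) (Sum.inl ⟨0, hN⟩) z
  have hcond₀ : 0 ≤ condNumber (gramMatrix α hα₀ N) := mul_nonneg (norm_nonneg _) (norm_nonneg _)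
  calc ‖(∑ i, a i • legendreSeq i).eval 1‖ ^ 2
      ≤ (∑ i, ‖a i‖ ^ 2) * (((N / 2 : ℕ) : ℝ) ^ 2 / 2) := norm_eval_one_sum_legendreSeq_sq_le a
    _ ≤ 2 * K ^ 2 * condNumber (gramMatrix α hα₀ N) * (((N / 2 : ℕ) : ℝ) ^ 2 / 2) := by
        gcongr
        exact ha.trans (hz.trans (by gcongr))
    _ = K ^ 2 * ((N / 2 : ℕ) : ℝ) ^ 2 * condNumber (gramMatrix α hα₀ N) := by ring

/-- The polynomial `∑ a k x ^ k`, `k < n`, in the variable `x = (1 + t) / 2`, which maps `(-1, 1)`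
onto the interval `(0, 1)` where Müntz polynomials are controlled. -/
noncomputable def halfShiftPoly (a : ℕ → ℝ) (n : ℕ) : ℂ[X] :=
  ∑ k ∈ Finset.range n, C (a k : ℂ) * (C (1 / 2) * X + C (1 / 2)) ^ k

theorem degree_halfShiftPoly_lt (a : ℕ → ℝ) (n : ℕ) : (halfShiftPoly a n).degree < n := by
  refine mem_degreeLT.mp <| Submodule.sum_mem _ fun k hk => mem_degreeLT.mpr ?_
  refine lt_of_le_of_lt (b := (k : WithBot ℕ)) ?_ (by exact_mod_cast Finset.mem_range.mp hk)
  rw [← smul_eq_C_mul]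
  exact (degree_smul_le _ _).trans ((degree_pow_le _ k).trans (by simp))

theorem eval_halfShiftPoly (a : ℕ → ℝ) (n : ℕ) (t : ℂ) :
    (halfShiftPoly a n).eval t = ∑ k ∈ Finset.range n, (a k : ℂ) * ((1 + t) / 2) ^ k := by
  rw [halfShiftPoly, eval_finsetSum]
  refine Finset.sum_congr rfl fun k _ => ?_
  simp only [eval_mul, eval_C, eval_pow, eval_add, eval_X]
  ring

theorem muntz_exponent_eq_eval_add_weight_mul_eval (α : ℝ) (n : ℕ) {t : ℝ} (ht : -1 < t) :
    (muntz (exponentIndex n) (exponent α) ((1 + t) / 2) : ℂ) =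
      (halfShiftPoly (fun k => exponentWeight α n (Sum.inl k)) n).eval (t : ℂ) +
      (weight α t : ℂ) *
        (halfShiftPoly (fun k => 2 ^ (-α) * exponentWeight α n (Sum.inr k)) n).eval (t : ℂ) := by
  have hweight : ((1 + t) / 2) ^ α = weight α t * 2 ^ (-α) := by
    rw [weight, Real.div_rpow (by linarith) zero_le_two, Real.rpow_neg zero_le_two, div_eq_mul_inv]
  have hsum := sum_exponentIndex_mul_rpow α n (fun i => (exponentWeight α n i : ℂ))
    (by linarith : 0 < (1 + t) / 2)
  rw [muntz, ← exponentWeight, Complex.ofReal_sum]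
  simp only [Complex.ofReal_mul, hsum, hweight, eval_halfShiftPoly, mul_assoc, Finset.mul_sum]
  push_cast
  rfl

theorem centralBinom_sq_le_mul_condNumber {α : ℝ} (hα₀ : 0 < α) (hα₁ : α < 1) {m N : ℕ}
    (hN : N / 2 = m + 1) :
    (m.centralBinom : ℝ) ^ 2 ≤ (m + 1) ^ 2 * condNumber (gramMatrix α hα₀ N) := by
  set W := exponentWeight α (m + 1)
  set p := halfShiftPoly (fun k => W (Sum.inl k)) (m + 1)
  set q := halfShiftPoly (fun k => 2 ^ (-α) * W (Sum.inr k)) (m + 1)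
  have hbound (t : ℝ) (ht : t ∈ Set.Ioo (-1 : ℝ) 1) :
      ‖p.eval (t : ℂ) + (weight α t : ℂ) * q.eval (t : ℂ)‖ ≤ W (Sum.inl 0) := by
    obtain ⟨hnonneg, hle⟩ := muntz_exponent_mem_Icc hα₀ hα₁ m
      (show (1 + t) / 2 ∈ Set.Ioc (0 : ℝ) 1 from ⟨by linarith [ht.1], by linarith [ht.2]⟩)
    rwa [← muntz_exponent_eq_eval_add_weight_mul_eval α (m + 1) ht.1, Complex.norm_real,
      Real.norm_of_nonneg hnonneg]
  have hp : m.centralBinom * W (Sum.inl 0) ≤ ‖p.eval 1‖ := by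
    have hone : p.eval 1 = ((∑ k ∈ Finset.range (m + 1), W (Sum.inl k) : ℝ) : ℂ) := by
      simp [p, eval_halfShiftPoly, one_add_one_eq_two]
    rw [hone, Complex.norm_real]
    exact (centralBinom_mul_exponentWeight_le_sum hα₀ hα₁ m).trans (le_abs_self _)
  have hcast : ((N / 2 : ℕ) : ℝ) = m + 1 := by rw [hN, Nat.cast_succ]
  have hcond := norm_eval_one_sq_le_mul_condNumber hα₀ hα₁ (hN ▸ m.succ_pos)
    (hN.symm ▸ degree_halfShiftPoly_lt _ _ : p.degree < (N / 2 : ℕ))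
    (hN.symm ▸ degree_halfShiftPoly_lt _ _ : q.degree < (N / 2 : ℕ)) hbound
  have hW : 0 < W (Sum.inl 0) := by
    rw [show W (Sum.inl 0) = _ from exponentWeight_inl_zero α m]
    exact inv_pos.mpr (mul_pos hα₀ (factorialMulRising_pos (by linarith) m))
  refine le_of_mul_le_mul_left ?_ (pow_pos hW 2)
  calc W (Sum.inl 0) ^ 2 * (m.centralBinom : ℝ) ^ 2
      = (m.centralBinom * W (Sum.inl 0)) ^ 2 := by rw [mul_pow, mul_comm]
    _ ≤ ‖p.eval 1‖ ^ 2 := by gcongr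
    _ ≤ W (Sum.inl 0) ^ 2 * (m + 1) ^ 2 * condNumber (gramMatrix α hα₀ N) := hcast ▸ hcond
    _ = W (Sum.inl 0) ^ 2 * ((m + 1) ^ 2 * condNumber (gramMatrix α hα₀ N)) := mul_assoc _ _ _

end ConditionNumber

end LegendreFrame

theorem proposition4 (α : ℝ) (hα₀ : 0 < α) (hα₁ : α < 1) :
    ∃ k : ℕ, ∃ c : ℝ, 0 < c ∧ ∀ᶠ N : ℕ in Filter.atTop, Even N →
      c * 4 ^ N / (N : ℝ) ^ k ≤
        LegendreFrame.condNumber (LegendreFrame.gramMatrix α hα₀ N) := by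
  refine ⟨4, 1, one_pos, ?_⟩
  filter_upwards [Filter.eventually_ge_atTop 10] with N hN hev
  obtain ⟨m, rfl⟩ : ∃ m, N = 2 * (m + 1) := by
    obtain ⟨r, rfl⟩ := hev
    exact ⟨r - 1, by lia⟩
  have hcond := LegendreFrame.centralBinom_sq_le_mul_condNumber hα₀ hα₁
    (Nat.mul_div_cancel_left (m + 1) two_pos)
  have hbinom : (4 : ℝ) ^ m ≤ (m + 1) * m.centralBinom := by
    exact_mod_cast (Nat.four_pow_lt_mul_centralBinom m (by lia)).le.trans (by gcongr; lia)
  rw [one_mul, div_le_iff₀ (by positivity)]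
  calc (4 : ℝ) ^ (2 * (m + 1)) = 16 * (4 ^ m) ^ 2 := by ring
    _ ≤ 16 * ((m + 1) * m.centralBinom) ^ 2 := by gcongr
    _ = 16 * (m + 1) ^ 2 * m.centralBinom ^ 2 := by ring
    _ ≤ 16 * (m + 1) ^ 2 * ((m + 1) ^ 2 * _) := by gcongr
    _ = _ * ((2 * (m + 1) : ℕ) : ℝ) ^ 4 := by push_cast; ring
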